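/- Fix an integer $k\ge 1$. A function $f:\mathbb{R}\to\mathbb{C}$ is a characteristic function (CF) if it is the characteristic function of a Borel probability measure on $\mathbb{R}$; a CF $h$ is infinitely divisible if for every integer $n\ge 1$ there is a CF $g$ with $h=g^n$. For $a>1$ the Harris$(a,k)$ law is the probability law on $\{1,1+k,1+2k,\dots\}$ with probability generating function $$P_{a}(s)=\frac{s}{\{a-(a-1)s^k\}^{1/k}},\qquad |s|\le 1,$$ with the principal $k$-th root. A CF $f$ is Harris-infinitely divisible (Harris-ID, for the given $k$) if for every $a>1$ there is a CF $f_a$ such that $f(t)=P_a(f_a(t))$ for all $t\in\mathbb{R}$. **Theorem.** A CF $f$ is Harris-ID if and only if there is an infinitely divisible CF $h$ such that $$f(t)=\frac{1}{(1-\log h(t))^{1/k}}\qquad\text{for all } t\in\mathbb{R},$$ where $\log h$ is the continuous function with $\log h(0)=0$ and $e^{\log h}=h$, and the $k$-th root is the principal one. -/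

import Mathlib

open MeasureTheory
open scoped ENNReal

/-- `f : ℝ → ℂ` is a characteristic function (CF): the characteristic function of some Borel
probability measure on the real line. -/
def IsCharFun (f : ℝ → ℂ) : Prop :=
  ∃ μ : Measure ℝ, IsProbabilityMeasure μ ∧ ∀ t, f t = charFun μ t

/-- A CF `h` is infinitely divisible: for every positive integer `n` it is the `n`-th power of
some CF. -/
def IsInfDivCharFun (h : ℝ → ℂ) : Prop :=
  IsCharFun h ∧ ∀ n : ℕ, 0 < n → ∃ g : ℝ → ℂ, IsCharFun g ∧ ∀ t, h t = g t ^ n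

/-- The probability generating function of a law on `ℕ`, as a function of a complex variable
(the series converges absolutely on the closed unit disc). -/
noncomputable def probGenFun (N : PMF ℕ) (z : ℂ) : ℂ :=
  ∑' n : ℕ, ((N n).toReal : ℂ) * z ^ n

/-- For a family of laws `N θ`, a function `f` is `N`-infinitely divisible if for every
`θ` there is a CF `g` with `f = P_θ ∘ g`, where `P_θ` is the probability generating function
of `N θ`. -/
def IsNInfDiv {Θ : Type*} (N : Θ → PMF ℕ) (f : ℝ → ℂ) : Prop :=
  ∀ θ, ∃ g : ℝ → ℂ, IsCharFun g ∧ ∀ t, f t = probGenFun (N θ) (g t)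

/-- The mass `(1/k)(1/k + 1)⋯(1/k + j - 1) / j! · (1/a)^(1/k) · (1 - 1/a)^j` which the
Harris(a,k) law gives to the point `1 + k * j`. -/
noncomputable def harrisWeight (k : ℕ+) (a : ℝ) (j : ℕ) : ℝ :=
  (ascPochhammer ℝ j).eval (1 / (k : ℝ)) / (j.factorial : ℝ)
    * ((1 / a) ^ (1 / (k : ℝ)) * (1 - 1 / a) ^ j)

theorem harrisWeight_nonneg (k : ℕ+) {a : ℝ} (ha : 1 < a) (j : ℕ) : 0 ≤ harrisWeight k a j := by
  have hk : (0 : ℝ) < 1 / (k : ℝ) := by positivity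
  have h1 := ascPochhammer_pos j _ hk
  have h2 : 0 ≤ 1 - 1 / a := by
    rw [sub_nonneg, div_le_one (by linarith)]
    exact ha.le
  unfold harrisWeight
  positivity

theorem ringChoose_eq_ascPochhammer (x : ℂ) (j : ℕ) :
    Ring.choose (x + j - 1) j = (ascPochhammer ℂ j).eval x / (j.factorial : ℂ) := by
  have h0 : (j.factorial : ℂ) ≠ 0 := by exact_mod_cast j.factorial_ne_zero
  have h := Ring.factorial_nsmul_multichoose_eq_ascPochhammer x j
  rw [Polynomial.ascPochhammer_smeval_eq_eval, nsmul_eq_mul] at h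
  rw [eq_div_iff h0, ← h, mul_comm, Ring.choose]
  congr 2
  ring

theorem hasSum_harrisWeight (k : ℕ+) {a : ℝ} (ha : 1 < a) {z : ℂ} (hz : ‖z‖ ≤ 1) :
    HasSum (fun j : ℕ => (harrisWeight k a j : ℂ) * z ^ j)
      (1 / ((a : ℂ) - ((a : ℂ) - 1) * z) ^ (1 / (k : ℂ))) := by
  have ha0 : 0 < a := by linarith
  have hac : (a : ℂ) ≠ 0 := by exact_mod_cast ha0.ne'
  have h2 : 0 ≤ 1 - 1 / a := by
    rw [sub_nonneg, div_le_one ha0]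
    exact ha.le
  set q : ℝ := 1 - 1 / a with hq
  have hq1 : q < 1 := by
    have : 0 < 1 / a := by positivity
    linarith
  have hball : (q : ℂ) * z ∈ Metric.eball (0 : ℂ) 1 := by
    rw [← ENNReal.ofReal_one, Metric.eball_ofReal, mem_ball_zero_iff, norm_mul,
      Complex.norm_real, Real.norm_of_nonneg h2]
    nlinarith [norm_nonneg z]
  have hs := (Complex.one_div_one_sub_cpow_hasFPowerSeriesOnBall_zero
    (1 / (k : ℂ))).hasSum hball
  have hs2 := hs.mul_left (((1 / a : ℝ) ^ (1 / (k : ℝ)) : ℝ) : ℂ)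
  have hc : ∀ j : ℕ, (harrisWeight k a j : ℂ) * z ^ j =
      (((1 / a : ℝ) ^ (1 / (k : ℝ)) : ℝ) : ℂ) *
        ((FormalMultilinearSeries.ofScalars ℂ
          (fun n : ℕ => Ring.choose (1 / (k : ℂ) + n - 1) n) j) fun _ => (q : ℂ) * z) := by
    intro j
    rw [FormalMultilinearSeries.ofScalars_apply_eq, ringChoose_eq_ascPochhammer]
    have h3 : (((ascPochhammer ℝ j).eval (1 / (k : ℝ)) : ℝ) : ℂ)
        = (ascPochhammer ℂ j).eval (1 / (k : ℂ)) := by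
      rw [← ascPochhammer_map Complex.ofRealHom j, Polynomial.eval_map,
        ← Complex.ofRealHom_eq_coe, ← Polynomial.eval₂_at_apply]
      simp
    unfold harrisWeight
    rw [← hq, smul_eq_mul, mul_pow, ← h3]
    push_cast
    ring
  have hv : 1 / ((a : ℂ) - ((a : ℂ) - 1) * z) ^ (1 / (k : ℂ)) =
      (((1 / a : ℝ) ^ (1 / (k : ℝ)) : ℝ) : ℂ) *
        (1 / (1 - (0 + (q : ℂ) * z)) ^ (1 / (k : ℂ))) := by
    have e : (a : ℂ) - ((a : ℂ) - 1) * z = (a : ℂ) * (1 - (q : ℂ) * z) := by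
      rw [hq]
      push_cast
      field_simp
    have e2 : ((1 / a : ℝ) ^ (1 / (k : ℝ)) : ℝ) = 1 / (a ^ (1 / (k : ℝ))) := by
      rw [Real.div_rpow zero_le_one ha0.le, Real.one_rpow]
    have hw : 1 - (q : ℂ) * z ≠ 0 := by
      intro h0
      rw [sub_eq_zero] at h0
      have h1 : ‖(q : ℂ) * z‖ < 1 := by
        rwa [← ENNReal.ofReal_one, Metric.eball_ofReal, mem_ball_zero_iff] at hball
      rw [← h0, norm_one] at h1
      exact lt_irrefl _ h1
    have e3 : ((a : ℂ) * (1 - (q : ℂ) * z)) ^ (1 / (k : ℂ)) =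
        (a : ℂ) ^ (1 / (k : ℂ)) * (1 - (q : ℂ) * z) ^ (1 / (k : ℂ)) := by
      rw [Complex.cpow_def_of_ne_zero (mul_ne_zero hac hw), Complex.cpow_def_of_ne_zero hac,
        Complex.cpow_def_of_ne_zero hw, Complex.log_ofReal_mul ha0 hw,
        Complex.ofReal_log ha0.le, add_mul, Complex.exp_add]
    rw [zero_add, e, e3, e2, Complex.ofReal_div, Complex.ofReal_cpow ha0.le]
    push_cast
    rw [one_div_mul_one_div]
  simp_rw [hc]
  rw [hv]
  exact hs2

/-- The law of `j` when `1 + k * j` has the Harris(a,k) law. -/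
noncomputable def harrisIndexLaw (k : ℕ+) (a : Set.Ioi (1 : ℝ)) : PMF ℕ :=
  ⟨fun j => ENNReal.ofReal (harrisWeight k a j), by
    have h := hasSum_harrisWeight k a.2 (z := 1) (by simp)
    simp only [one_pow, mul_one, sub_sub_cancel, Complex.one_cpow, div_one] at h
    have h' : HasSum (harrisWeight k a) 1 := by
      have h3 := Complex.reCLM.hasSum h
      simpa using h3
    have h2 := ENNReal.ofReal_tsum_of_nonneg (harrisWeight_nonneg k a.2) h'.summable
    rw [h'.tsum_eq, ENNReal.ofReal_one] at h2
    rw [h2]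
    exact ENNReal.summable.hasSum⟩

/-- The Harris(a,k) law on `{1, 1 + k, 1 + 2k, …}`. -/
noncomputable def harrisLaw (k : ℕ+) (a : Set.Ioi (1 : ℝ)) : PMF ℕ :=
  PMF.map (fun j : ℕ => 1 + (k : ℕ) * j) (harrisIndexLaw k a)

/-- The probability generating function of the Harris(a,k) law is `z / (a - (a - 1) z ^ k)^(1/k)`.
On the closed unit disc the base of the root has real part at least `1`, and the root is the
principal one. -/
theorem probGenFun_harrisLaw (k : ℕ+) (a : Set.Ioi (1 : ℝ)) {z : ℂ} (hz : ‖z‖ ≤ 1) :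
    probGenFun (harrisLaw k a) z =
      z / (((a : ℝ) : ℂ) - (((a : ℝ) : ℂ) - 1) * z ^ (k : ℕ)) ^ (1 / (k : ℂ)) := by
  have hinj : Function.Injective (fun j : ℕ => 1 + (k : ℕ) * j) := by
    intro i j hij
    exact Nat.eq_of_mul_eq_mul_left k.pos (Nat.add_left_cancel hij)
  have h := hasSum_harrisWeight k a.2 (z := z ^ (k : ℕ))
    (by rw [norm_pow]; exact pow_le_one₀ (norm_nonneg _) hz)
  unfold probGenFun
  rw [← hinj.tsum_eq]
  · have hm : ∀ j : ℕ, (harrisLaw k a) (1 + (k : ℕ) * j) =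
        ENNReal.ofReal (harrisWeight k a j) := by
      intro j
      unfold harrisLaw
      rw [PMF.map_apply, tsum_eq_single j]
      · simp only [if_true]
        rfl
      · intro i hi
        rw [if_neg]
        intro hij
        exact hi (hinj hij).symm
    simp_rw [hm, ENNReal.toReal_ofReal (harrisWeight_nonneg k a.2 _)]
    have h2 := h.mul_left z
    rw [mul_one_div] at h2
    rw [← h2.tsum_eq]
    congr 1
    funext j
    rw [pow_add, pow_mul]
    ring
  · intro n hn
    by_contra hne
    apply hn
    have h0 : (harrisLaw k a) n = 0 := by
      unfold harrisLaw
      rw [PMF.map_apply]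
      refine ENNReal.tsum_eq_zero.2 fun j => ?_
      rw [if_neg]
      intro hj
      exact hne ⟨j, hj.symm⟩
    simp [h0]

/-- A function `f` is Harris-infinitely divisible (for the integer `k`) if it is infinitely
divisible with respect to the family of all Harris(a,k) laws, `a > 1`. -/
def IsHarrisInfDiv (k : ℕ+) (f : ℝ → ℂ) : Prop :=
  IsNInfDiv (harrisLaw k) f

/-- `L` is the (distinguished) logarithm of `h : ℝ → ℂ`: the continuous function with
`exp ∘ L = h` and `L 0 = 0`. -/
def IsLogOf (L h : ℝ → ℂ) : Prop :=
  Continuous L ∧ L 0 = 0 ∧ ∀ t, Complex.exp (L t) = h t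

/-- The logarithm of `h` is unique, so one may speak of `log h`. -/
theorem IsLogOf.unique {L M h : ℝ → ℂ} (hL : IsLogOf L h) (hM : IsLogOf M h) : L = M := by
  refine Complex.isCoveringMap_exp.eq_of_comp_eq hL.1 hM.1 ?_ 0 (hL.2.1.trans hM.2.1.symm)
  funext t
  exact Subtype.ext ((hL.2.2 t).trans (hM.2.2 t).symm)

/-! Put `u = f ^ k` and `v = f_a ^ k`. The Harris equation becomes the geometric one, `u = v / (a -
(a - 1) v)`, which is affine in reciprocals: `1 - 1 / v = (1 - 1 / u) / a`. Hence `L = 1 - 1 / u` is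
the candidate for `log h`, and `v = 1 / (1 - L / a)`. Forward: as `a → ∞`, `v` tends to the
indicator of `u ≠ 0`; by Lévy's theorem this is a CF, so by continuity `u` has no zeros. With `a = n
m`, the powers `v ^ m` tend to `exp (L / n)`, an `n`-th root of `exp L`
(`IsCharFun.exp_div_of_geometric`). Converse: `(1 - L / a) ^ (-1 / k)` is a limit of Harris mixtures
of the roots `exp (L / n)` (`IsInfDivCharFun.one_div_one_sub_cpow`), and it serves as `f_a`. Algebra
only gives equality of `k`-th powers; `eq_of_pow_eq_of_continuous` removes the ambiguity of the
root. -/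

open Filter Topology

/-! ### Closure properties of characteristic functions -/

namespace IsCharFun

theorem norm_le_one {g : ℝ → ℂ} (hg : IsCharFun g) (t : ℝ) : ‖g t‖ ≤ 1 := by
  obtain ⟨μ, hμ, h⟩ := hg
  rw [h t]
  exact norm_charFun_le_one t

theorem continuous {g : ℝ → ℂ} (hg : IsCharFun g) : Continuous g := by
  obtain ⟨μ, hμ, h⟩ := hg
  rw [funext h]
  exact continuous_charFun

theorem apply_zero {g : ℝ → ℂ} (hg : IsCharFun g) : g 0 = 1 := by
  obtain ⟨μ, hμ, h⟩ := hg
  rw [h 0]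
  simp

theorem one : IsCharFun fun _ => 1 :=
  ⟨Measure.dirac 0, inferInstance, fun t => by simp [charFun_dirac]⟩

theorem mul {g h : ℝ → ℂ} (hg : IsCharFun g) (hh : IsCharFun h) :
    IsCharFun fun t => g t * h t := by
  obtain ⟨μ, hμ, hgμ⟩ := hg
  obtain ⟨ν, hν, hhν⟩ := hh
  exact ⟨μ ∗ ν, inferInstance, fun t => by
    simp only [charFun_conv, hgμ, hhν]⟩

theorem pow {g : ℝ → ℂ} (hg : IsCharFun g) (n : ℕ) : IsCharFun fun t => g t ^ n := by
  induction n with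
  | zero => simpa using one
  | succ n ih => simpa only [pow_succ] using ih.mul hg

/-- Lévy's continuity theorem: a pointwise limit of characteristic functions that is continuous
at the origin is a characteristic function. -/
theorem of_tendsto {g : ℕ → ℝ → ℂ} (hg : ∀ n, IsCharFun (g n)) {f : ℝ → ℂ}
    (hf : ContinuousAt f 0) (h : ∀ t, Tendsto (fun n => g n t) atTop (𝓝 (f t))) :
    IsCharFun f := by
  choose μ hμ hgμ using hg
  simp_rw [hgμ] at h
  have htight := isTightMeasureSet_of_tendsto_charFun hf h
  let ν : ℕ → ProbabilityMeasure ℝ := fun n => ⟨μ n, hμ n⟩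
  have hcompact : IsCompact (closure (Set.range ν)) := by
    apply isCompact_closure_of_isTightMeasureSet
    convert htight
    ext m
    simp only [Set.mem_range, exists_exists_eq_and]
    rfl
  -- Convergence along an ultrafilter finer than `atTop` replaces the extraction of a subsequence.
  obtain ⟨m, -, hm⟩ := hcompact.ultrafilter_le_nhds ((hyperfilter ℕ).map ν)
    (.trans (by simp) (monotone_principal subset_closure))
  have hm' : Tendsto ν (hyperfilter ℕ) (𝓝 m) := hm
  refine ⟨m, inferInstance, fun t => ?_⟩
  rw [ProbabilityMeasure.tendsto_iff_forall_integral_rclike_tendsto ℂ] at hm'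
  have h1 := hm' (BoundedContinuousFunction.innerProbChar t)
  simp_rw [← charFun_eq_integral_innerProbChar] at h1
  exact tendsto_nhds_unique ((h t).mono_left Nat.hyperfilter_le_atTop) h1

/-- A countable mixture of powers of a characteristic function is a characteristic function. -/
theorem of_hasSum_pow {g : ℝ → ℂ} (hg : IsCharFun g) {w : ℕ → ℝ} (hw : ∀ j, 0 ≤ w j)
    (hw1 : HasSum w 1) {f : ℝ → ℂ} (hf : ∀ t, HasSum (fun j => (w j : ℂ) * g t ^ j) (f t)) :
    IsCharFun f := by
  choose μ hμ hgμ using fun j => hg.pow j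
  let m : Measure ℝ := Measure.sum fun j => ENNReal.ofReal (w j) • μ j
  have hm : IsProbabilityMeasure m := by
    constructor
    rw [Measure.sum_apply _ MeasurableSet.univ]
    simp only [Measure.smul_apply, measure_univ, smul_eq_mul, mul_one]
    rw [← ENNReal.ofReal_tsum_of_nonneg hw hw1.summable, hw1.tsum_eq, ENNReal.ofReal_one]
  refine ⟨m, hm, fun t => ?_⟩
  have h1 := hasSum_integral_measure
    (BoundedContinuousFunction.integrable m (BoundedContinuousFunction.innerProbChar t))
  rw [← charFun_eq_integral_innerProbChar] at h1
  refine (hf t).unique ?_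
  have h2 : ∀ j, ∫ x, BoundedContinuousFunction.innerProbChar t x
      ∂(ENNReal.ofReal (w j) • μ j) = (w j : ℂ) * g t ^ j := by
    intro j
    rw [integral_smul_measure, ENNReal.toReal_ofReal (hw j), Complex.real_smul,
      ← charFun_eq_integral_innerProbChar]
    exact congrArg _ (hgμ j t).symm
  simpa only [h2] using h1

end IsCharFun

/-! ### Continuous choice of `k`-th roots -/

/-- Two continuous functions on the line with the same nowhere vanishing `k`-th power agree as
soon as they agree at the origin. -/
theorem eq_of_pow_eq_of_continuous {p q : ℝ → ℂ} (hp : Continuous p) (hq : Continuous q) {k : ℕ}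
    (hk : 0 < k) (hpq : ∀ t, p t ^ k = q t ^ k) (hq0 : ∀ t, q t ≠ 0) (h0 : p 0 = q 0) : p = q := by
  have hfin : {z : ℂ | z ^ k = 1}.Finite := by
    refine (Polynomial.nthRootsFinset k (1 : ℂ)).finite_toSet.subset fun z hz => ?_
    exact (Polynomial.mem_nthRootsFinset hk _).2 hz
  funext t
  -- The quotient `p / q` is continuous with values in the finite set of `k`-th roots of unity,
  -- hence constant.
  have h := isPreconnected_univ.constant_of_mapsTo hfin.isDiscrete
    (hp.div hq hq0).continuousOn (fun s _ => by
      change (p s / q s) ^ k = 1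
      rw [div_pow, hpq, div_self (pow_ne_zero k (hq0 s))])
    (Set.mem_univ t) (Set.mem_univ 0)
  rw [Pi.div_apply, Pi.div_apply, h0, div_self (hq0 0)] at h
  exact (div_eq_one_iff_eq (hq0 t)).1 h

theorem one_div_cpow_one_div_pow (k : ℕ+) (z : ℂ) :
    (1 / z ^ (1 / (k : ℂ))) ^ (k : ℕ) = 1 / z := by
  rw [div_pow, one_pow, one_div (k : ℂ), Complex.cpow_nat_inv_pow z k.ne_zero]

/-- The half-plane `1 ≤ re` avoids both zero and the branch cut of the principal power. -/
theorem continuous_one_div_cpow_of_one_le_re {p : ℝ → ℂ} (hp : Continuous p)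
    (hre : ∀ t, 1 ≤ (p t).re) (c : ℂ) : Continuous fun t => 1 / p t ^ c := by
  have h0 : ∀ t, p t ≠ 0 := fun t h => by
    have := hre t
    rw [h, Complex.zero_re] at this
    linarith
  refine continuous_const.div (hp.cpow continuous_const fun t => Or.inl ?_) fun t h => ?_
  · linarith [hre t]
  · exact h0 t (Complex.cpow_eq_zero_iff _ _ |>.1 h).1

theorem one_le_re_sub_mul {a : ℝ} (ha : 1 < a) {v : ℂ} (hv : ‖v‖ ≤ 1) :
    1 ≤ ((a : ℂ) - ((a : ℂ) - 1) * v).re := by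
  have h : ((a : ℂ) - ((a : ℂ) - 1) * v).re = a - (a - 1) * v.re := by simp
  rw [h]
  nlinarith [(Complex.re_le_norm v).trans hv]

theorem one_le_re_one_sub_div {z : ℂ} (hz : z.re ≤ 0) {a : ℝ} (ha : 0 < a) :
    1 ≤ (1 - z / a).re := by
  rw [Complex.sub_re, Complex.one_re, Complex.div_ofReal_re]
  linarith [div_nonpos_of_nonpos_of_nonneg hz ha.le]

theorem IsLogOf.re_nonpos {L h : ℝ → ℂ} (hL : IsLogOf L h) (hh : IsCharFun h) (t : ℝ) :
    (L t).re ≤ 0 := by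
  have := hh.norm_le_one t
  rwa [← hL.2.2 t, Complex.norm_exp, Real.exp_le_one_iff] at this

theorem probGenFun_harrisLaw_pow (k : ℕ+) (a : Set.Ioi (1 : ℝ)) {z : ℂ} (hz : ‖z‖ ≤ 1) :
    probGenFun (harrisLaw k a) z ^ (k : ℕ) =
      z ^ (k : ℕ) / (((a : ℝ) : ℂ) - (((a : ℝ) : ℂ) - 1) * z ^ (k : ℕ)) := by
  rw [probGenFun_harrisLaw k a hz, ← mul_one_div, mul_pow, one_div_cpow_one_div_pow, mul_one_div]

/-! ### From Harris-infinite divisibility to an infinitely divisible `h` -/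

/-- The `k`-th power of a Harris-infinitely divisible characteristic function is geometrically
infinitely divisible. -/
theorem IsHarrisInfDiv.exists_charFun_pow {k : ℕ+} {f : ℝ → ℂ} (hf : IsHarrisInfDiv k f) {a : ℝ}
    (ha : 1 < a) : ∃ v : ℝ → ℂ, IsCharFun v ∧
      ∀ t, f t ^ (k : ℕ) * ((a : ℂ) - ((a : ℂ) - 1) * v t) = v t := by
  obtain ⟨g, hg, hfg⟩ := hf ⟨a, ha⟩
  refine ⟨_, hg.pow k, fun t => ?_⟩
  have hre := one_le_re_sub_mul ha ((hg.pow k).norm_le_one t)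
  rw [hfg t, probGenFun_harrisLaw_pow k ⟨a, ha⟩ (hg.norm_le_one t), div_mul_cancel₀]
  intro h
  simp only at hre h
  rw [h, Complex.zero_re] at hre
  linarith

/-- The solution `v` of `u = v / (a - (a - 1) v)` in terms of `1 - 1 / u`. -/
theorem mul_one_sub_div_eq_one {u v : ℂ} {a : ℝ} (ha : 1 < a) (hu : u ≠ 0)
    (h : u * ((a : ℂ) - ((a : ℂ) - 1) * v) = v) : v * (1 - (1 - 1 / u) / a) = 1 := by
  have ha0 : (a : ℂ) ≠ 0 := by
    exact_mod_cast (by linarith : a ≠ 0)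
  field_simp
  linear_combination -h

theorem tendsto_of_geometric {u : ℂ} {a : ℕ → ℝ} (ha : ∀ n, 1 < a n) (hat : Tendsto a atTop atTop)
    {v : ℕ → ℂ} (h : ∀ n, u * ((a n : ℂ) - ((a n : ℂ) - 1) * v n) = v n) (hu : u ≠ 0) :
    Tendsto v atTop (𝓝 1) := by
  have h1 : Tendsto (fun n => (a n : ℂ)⁻¹) atTop (𝓝 0) := by
    have := (Complex.continuous_ofReal.tendsto 0).comp hat.inv_tendsto_atTop
    simpa [Function.comp_def] using this
  have h2 : Tendsto (fun n => 1 / (1 - (1 - 1 / u) * (a n : ℂ)⁻¹)) atTop (𝓝 1) := by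
    have := tendsto_const_nhds (x := (1 : ℂ)) |>.div
      ((tendsto_const_nhds (x := (1 : ℂ))).sub (h1.const_mul (1 - 1 / u))) (by simp)
    simpa [Pi.div_def] using this
  refine h2.congr fun n => ?_
  rw [← div_eq_mul_inv]
  exact (eq_one_div_of_mul_eq_one_left (mul_one_sub_div_eq_one (ha n) hu (h n))).symm

/-- A geometrically infinitely divisible characteristic function has no zeros. -/
theorem IsCharFun.ne_zero_of_geometric {u : ℝ → ℂ} (hu : IsCharFun u)
    (h : ∀ a : ℝ, 1 < a → ∃ v : ℝ → ℂ, IsCharFun v ∧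
      ∀ t, u t * ((a : ℂ) - ((a : ℂ) - 1) * v t) = v t) (t : ℝ) : u t ≠ 0 := by
  classical
  have ha : ∀ n : ℕ, 1 < (n : ℝ) + 2 := fun n => by linarith [n.cast_nonneg (α := ℝ)]
  have hat : Tendsto (fun n : ℕ => (n : ℝ) + 2) atTop atTop :=
    tendsto_atTop_add_const_right _ _ tendsto_natCast_atTop_atTop
  choose v hv hvu using fun n : ℕ => h (n + 2) (ha n)
  let e : ℝ → ℂ := fun s => if u s = 0 then 0 else 1
  have hlim : ∀ s, Tendsto (fun n => v n s) atTop (𝓝 (e s)) := by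
    intro s
    by_cases hs : u s = 0
    · simp only [e, hs, if_true]
      refine tendsto_const_nhds.congr fun n => ?_
      rw [← hvu n s, hs, zero_mul]
    · simp only [e, hs, if_false]
      exact tendsto_of_geometric ha hat (fun n => hvu n s) hs
  have he0 : ContinuousAt e 0 := by
    have h1 : ∀ᶠ s in 𝓝 (0 : ℝ), u s ≠ 0 :=
      hu.continuous.continuousAt.eventually_ne (by simp [hu.apply_zero])
    refine (continuousAt_const (y := (1 : ℂ))).congr ?_
    filter_upwards [h1] with s hs
    simp [e, hs]
  have he := IsCharFun.of_tendsto hv he0 hlim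
  -- A continuous function with values in `{0, 1}` is constant, and `e 0 = 1`.
  have hconst := isPreconnected_univ.constant_of_mapsTo
    (Set.toFinite ({0, 1} : Set ℂ)).isDiscrete he.continuous.continuousOn
    (fun s _ => by by_cases hs : u s = 0 <;> simp [e, hs]) (Set.mem_univ t) (Set.mem_univ 0)
  rw [he.apply_zero] at hconst
  intro ht
  simp [e, ht] at hconst

/-- If `u` is geometrically infinitely divisible, then `exp ((1 - 1 / u) / n)` is a characteristic
function for all `n`. -/
theorem IsCharFun.exp_div_of_geometric {u : ℝ → ℂ} (hu : IsCharFun u)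
    (h : ∀ a : ℝ, 1 < a → ∃ v : ℝ → ℂ, IsCharFun v ∧
      ∀ t, u t * ((a : ℂ) - ((a : ℂ) - 1) * v t) = v t) {n : ℕ} (hn : 0 < n) :
    IsCharFun fun t => Complex.exp ((1 - 1 / u t) / n) := by
  have hu0 := hu.ne_zero_of_geometric h
  have hn1 : (1 : ℝ) ≤ n := by exact_mod_cast hn
  have ha : ∀ m : ℕ, 1 < (n : ℝ) * ((m + 2 : ℕ) : ℝ) := fun m => by
    push_cast
    nlinarith [m.cast_nonneg (α := ℝ)]
  -- The shift by 2 keeps the parameter above 1 even for `n = 1`.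
  choose v hv hvu using fun m : ℕ => h (n * (m + 2 : ℕ)) (ha m)
  have hcont : Continuous fun t => Complex.exp ((1 - 1 / u t) / n) :=
    Complex.continuous_exp.comp
      ((continuous_const.sub (continuous_const.div hu.continuous hu0)).div_const _)
  refine IsCharFun.of_tendsto (fun m => (hv m).pow (m + 2)) hcont.continuousAt fun t => ?_
  -- With `z = (1 - 1 / u) / n` and `M = m + 2`, `v ^ M = (1 - z / M) ^ (-M)`, which tends to `exp
  -- z`.
  have h1 := (tendsto_add_atTop_iff_nat 2).2
    (Complex.tendsto_one_add_div_pow_exp (-((1 - 1 / u t) / n)))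
  have h2 := h1.inv₀ (Complex.exp_ne_zero _)
  rw [← Complex.exp_neg, neg_neg] at h2
  refine h2.congr fun m => ?_
  have h3 := mul_one_sub_div_eq_one (ha m) (hu0 t) (hvu m t)
  rw [← inv_pow]
  congr 1
  refine (eq_inv_of_mul_eq_one_left ?_).symm
  rw [neg_div, ← sub_eq_add_neg, div_div]
  push_cast at h3 ⊢
  exact h3

theorem IsHarrisInfDiv.exists_infDiv {k : ℕ+} {f : ℝ → ℂ} (hf : IsCharFun f)
    (hH : IsHarrisInfDiv k f) :
    ∃ h : ℝ → ℂ, IsInfDivCharFun h ∧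
      ∃ L : ℝ → ℂ, IsLogOf L h ∧ ∀ t, f t = 1 / (1 - L t) ^ (1 / (k : ℂ)) := by
  have hgeo := fun (a : ℝ) (ha : 1 < a) => hH.exists_charFun_pow ha
  have hu := hf.pow k
  have hu0 := hu.ne_zero_of_geometric hgeo
  have hexp := fun (n : ℕ) (hn : 0 < n) => hu.exp_div_of_geometric hgeo hn
  let L : ℝ → ℂ := fun t => 1 - 1 / f t ^ (k : ℕ)
  have hLc : Continuous L := continuous_const.sub (continuous_const.div hu.continuous hu0)
  have hh : IsCharFun fun t => Complex.exp (L t) := by simpa [L] using hexp 1 one_pos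
  have hL : IsLogOf L fun t => Complex.exp (L t) :=
    ⟨hLc, by simp [L, hf.apply_zero], fun t => rfl⟩
  refine ⟨_, ⟨hh, fun n hn => ⟨_, hexp n hn, fun t => ?_⟩⟩, L, hL, fun t => ?_⟩
  · rw [← Complex.exp_nat_mul, mul_div_cancel₀]
    exact_mod_cast hn.ne'
  · refine congrFun (eq_of_pow_eq_of_continuous hf.continuous
      (continuous_one_div_cpow_of_one_le_re (p := fun t => 1 - L t) (continuous_const.sub hLc)
        (fun s => by simpa using one_le_re_one_sub_div (hL.re_nonpos hh s) one_pos) _) k.pos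
      (fun s => ?_) (fun s hs => ?_) ?_) t
    · rw [one_div_cpow_one_div_pow]
      simp [L]
    · have h1 := one_div_cpow_one_div_pow k (1 - L s)
      rw [hs, zero_pow k.ne_zero] at h1
      refine hu0 s ?_
      simpa [L] using h1.symm
    · simp [hf.apply_zero, hL.2.1]

/-! ### From an infinitely divisible `h` to Harris-infinite divisibility -/

/-- The `n`-th root of an infinitely divisible characteristic function is given by its
logarithm. -/
theorem IsInfDivCharFun.exp_div {h L : ℝ → ℂ} (hh : IsInfDivCharFun h) (hL : IsLogOf L h) {n : ℕ}
    (hn : 0 < n) : IsCharFun fun t => Complex.exp (L t / n) := by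
  obtain ⟨g, hg, hhg⟩ := hh.2 n hn
  have heq : g = fun t => Complex.exp (L t / n) := by
    refine eq_of_pow_eq_of_continuous hg.continuous
      (Complex.continuous_exp.comp (hL.1.div_const (n : ℂ))) hn (fun t => ?_)
      (fun t => Complex.exp_ne_zero _) ?_
    · rw [← hhg, ← hL.2.2 t, ← Complex.exp_nat_mul, mul_div_cancel₀]
      exact_mod_cast hn.ne'
    · simp [hg.apply_zero, hL.2.1]
  exact heq ▸ hg

/-- The law with probability generating function `(a - (a - 1) z) ^ (-1 / k)` yields compound
characteristic functions. -/
theorem IsCharFun.harris_mixture (k : ℕ+) {a : ℝ} (ha : 1 < a) {g : ℝ → ℂ} (hg : IsCharFun g) :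
    IsCharFun fun t => 1 / ((a : ℂ) - ((a : ℂ) - 1) * g t) ^ (1 / (k : ℂ)) := by
  refine hg.of_hasSum_pow (harrisWeight_nonneg k ha) ?_
    fun t => hasSum_harrisWeight k ha (hg.norm_le_one t)
  have h := hasSum_harrisWeight k ha (z := 1) (by simp)
  simp only [one_pow, mul_one, sub_sub_cancel, Complex.one_cpow, div_one] at h
  simpa using Complex.reCLM.hasSum h

/-- These are difference quotients at 0 of `x ↦ exp (x z)`, with step `1 / n`. -/
theorem tendsto_natCast_mul_exp_div_sub_one (z : ℂ) :
    Tendsto (fun n : ℕ => (n : ℂ) * (Complex.exp (z / n) - 1)) atTop (𝓝 z) := by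
  have h1 : HasDerivAt (fun x : ℂ => Complex.exp (x * z)) z 0 := by
    simpa using ((hasDerivAt_id (0 : ℂ)).mul_const z).cexp
  have h2 : Tendsto (fun n : ℕ => ((n : ℂ))⁻¹) atTop (𝓝[≠] 0) := by
    refine tendsto_nhdsWithin_iff.2 ⟨tendsto_inv_atTop_nhds_zero_nat, ?_⟩
    filter_upwards [eventually_gt_atTop 0] with n hn
    simpa using hn.ne'
  refine (h1.tendsto_slope_zero.comp h2).congr fun n => ?_
  simp [div_eq_inv_mul]

theorem IsInfDivCharFun.one_div_one_sub_cpow {h L : ℝ → ℂ} (hh : IsInfDivCharFun h)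
    (hL : IsLogOf L h) (k : ℕ+) {a : ℝ} (ha : 0 < a) :
    IsCharFun fun t => 1 / (1 - L t / a) ^ (1 / (k : ℂ)) := by
  have hre := fun t => one_le_re_one_sub_div (hL.re_nonpos hh.1 t) ha
  -- For `b = 1 + N / a`, `b - (b - 1) exp (L / N) = 1 - N (exp (L / N) - 1) / a`, which tends to `1
  -- - L / a`.
  have hb : ∀ n : ℕ, 1 < 1 + ((n + 1 : ℕ) : ℝ) / a := fun n => by
    have : 0 < ((n + 1 : ℕ) : ℝ) / a := by positivity
    linarith
  refine IsCharFun.of_tendsto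
    (fun n => (hh.exp_div hL n.succ_pos).harris_mixture k (hb n))
    (continuous_one_div_cpow_of_one_le_re (continuous_const.sub (hL.1.div_const _))
      hre _).continuousAt fun t => ?_
  have hslit : 1 - L t / a ∈ Complex.slitPlane := Or.inl (by linarith [hre t])
  have h1 := (tendsto_add_atTop_iff_nat 1).2 (tendsto_natCast_mul_exp_div_sub_one (L t))
  have h2 := ((h1.div_const (a : ℂ)).const_sub 1)
  refine (tendsto_const_nhds.div (h2.cpow tendsto_const_nhds hslit) ?_).congr fun n => ?_
  · exact fun h0 => Complex.slitPlane_ne_zero hslit (Complex.cpow_eq_zero_iff _ _ |>.1 h0).1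
  · rw [Pi.div_apply]
    congr 2
    push_cast
    ring

theorem IsInfDivCharFun.isHarrisInfDiv {h L : ℝ → ℂ} (hh : IsInfDivCharFun h) (hL : IsLogOf L h)
    {k : ℕ+} {f : ℝ → ℂ} (hf : ∀ t, f t = 1 / (1 - L t) ^ (1 / (k : ℂ))) :
    IsHarrisInfDiv k f := by
  intro a
  have ha : (1 : ℝ) < a := a.2
  have ha0 : (0 : ℝ) < a := by linarith
  have hac : ((a : ℝ) : ℂ) ≠ 0 := by exact_mod_cast ha0.ne'
  have hg := hh.one_div_one_sub_cpow hL k ha0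
  have hfc : IsCharFun f := by
    rw [funext hf]
    simpa using hh.one_div_one_sub_cpow hL k one_pos
  have hne : ∀ {b : ℝ}, 0 < b → ∀ t, 1 - L t / b ≠ 0 := fun hb t h0 => by
    have := one_le_re_one_sub_div (hL.re_nonpos hh.1 t) hb
    rw [h0, Complex.zero_re] at this
    linarith
  refine ⟨_, hg, fun t => ?_⟩
  -- Both sides have `k`-th power `1 / (1 - L)` and equal 1 at the origin.
  refine congrFun (eq_of_pow_eq_of_continuous (q := f)
    (p := fun s => probGenFun (harrisLaw k a) (1 / (1 - L s / a) ^ (1 / (k : ℂ)))) ?_ hfc.continuous k.pos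
    (fun s => ?_) (fun s hs => ?_) ?_).symm t
  · simp_rw [fun s => probGenFun_harrisLaw k a (hg.norm_le_one s), ← mul_one_div (_ / _) (_ ^ _)]
    exact hg.continuous.mul (continuous_one_div_cpow_of_one_le_re
      (continuous_const.sub (continuous_const.mul (hg.continuous.pow _)))
      (fun s => one_le_re_sub_mul ha ((hg.pow k).norm_le_one s)) _)
  · have h1 := hne ha0 s
    have h2 := hne one_pos s
    rw [Complex.ofReal_one, div_one] at h2
    rw [probGenFun_harrisLaw_pow k a (hg.norm_le_one s), one_div_cpow_one_div_pow, hf,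
      one_div_cpow_one_div_pow]
    have h3 : ((a : ℝ) : ℂ) - (((a : ℝ) : ℂ) - 1) * (1 / (1 - L s / ((a : ℝ) : ℂ))) =
        (1 - L s) / (1 - L s / ((a : ℝ) : ℂ)) := by
      rw [mul_one_div, eq_div_iff h1, sub_mul, div_mul_cancel₀ _ h1, mul_sub, mul_div_cancel₀ _ hac]
      ring
    rw [h3, div_div_div_cancel_right₀ h1]
  · have h2 := hne one_pos s
    rw [Complex.ofReal_one, div_one] at h2
    have h1 := one_div_cpow_one_div_pow k (1 - L s)
    rw [← hf, hs, zero_pow k.ne_zero] at h1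
    exact one_div_ne_zero h2 h1.symm
  · rw [probGenFun_harrisLaw k a (hg.norm_le_one 0)]
    simp [hfc.apply_zero, hL.2.1]

theorem theorem2p2 (k : ℕ+) (f : ℝ → ℂ) (hf : IsCharFun f) :
    IsHarrisInfDiv k f ↔
      ∃ h : ℝ → ℂ, IsInfDivCharFun h ∧
        ∃ L : ℝ → ℂ, IsLogOf L h ∧ ∀ t, f t = 1 / (1 - L t) ^ (1 / (k : ℂ)) :=
  ⟨fun hH => hH.exists_infDiv hf, fun ⟨_, hh, _, hL, hfL⟩ => hh.isHarrisInfDiv hL hfL⟩
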